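/- Let $\mathbf{k}$ be an algebraically closed field of characteristic $p>2$, and let $\bar V$ be a $\mathbf{k}$-vector space of dimension $p-1$, regarded as a graded module concentrated in degree $1$. Equip the tensor algebra $T(\bar V)=\bigoplus_n \bar V^{\otimes n}$ with the graded commutator $[a,b]=ab-(-1)^{mn}ba$ for $a\in\bar V^{\otimes m}$, $b\in\bar V^{\otimes n}$. Let $L(\bar V)\subseteq T(\bar V)$ be the graded Lie subalgebra generated by $\bar V$ (the free graded Lie algebra), let $L_n(\bar V)=L(\bar V)\cap\bar V^{\otimes n}$, and put $$\bar L_p(\bar V)=L_p(\bar V)\Big/\sum_{i=2}^{p-2}[L_i(\bar V),L_{p-i}(\bar V)].$$ Let $\beta_p\colon \bar V^{\otimes p}\to L_p(\bar V)$ be the linear map $x_1\otimes\cdots\otimes x_p\mapsto[[\cdots[[x_1,x_2],x_3],\cdots],x_p]$, and let $E_{p-1}(\bar V)=\Lambda^{p-1}(\bar V)$ be the exterior power. The general linear group $\mathrm{GL}(\bar V)$ acts on all these spaces through its action on $\bar V$. Then the $\mathrm{GL}(\bar V)$-equivariant map $\beta_p$ and the quotient map $L_p(\bar V)\to\bar L_p(\bar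 V)$ are surjective, and there is a $\mathrm{GL}(\bar V)$-equivariant isomorphism $\bar L_p(\bar V)\cong\bar V\otimes E_{p-1}(\bar V)$. For every such isomorphism, the composite $$q\colon \bar V^{\otimes p}\xrightarrow{\ \beta_p\ }L_p(\bar V)\longrightarrow\bar L_p(\bar V)\xrightarrow{\ \cong\ }\bar V\otimes E_{p-1}(\bar V)$$ has no $\mathrm{GL}(\bar V)$-equivariant cross-section: there is no $\mathrm{GL}(\bar V)$-equivariant linear map $\phi\colon\bar V\otimes E_{p-1}(\bar V)\to\bar V^{\otimes p}$ with $q\circ\phi=\mathrm{id}$. -/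

import Mathlib

open scoped TensorProduct

noncomputable section

namespace OddLie

/-! Throughout, `V` is a `k`-vector space regarded as a graded module concentrated in degree `1`.
A tensor of length `n` over `V` therefore has degree `n`, and the sign rule of the graded bracket
only involves tensor lengths. -/

variable (k : Type*) [Field k] (V : Type*) [AddCommGroup V] [Module k V]

/-- The graded commutator `[a, b] = a b - (-1)^(m n) b a` in the tensor algebra, for `a` of
degree `m` and `b` of degree `n`, as a bilinear map. -/
def bracket (m n : ℕ) :
    TensorAlgebra k V →ₗ[k] TensorAlgebra k V →ₗ[k] TensorAlgebra k V :=
  LinearMap.mul k (TensorAlgebra k V)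
    - (-1 : k) ^ (m * n) • (LinearMap.mul k (TensorAlgebra k V)).flip

variable {k V} in
theorem bracket_apply (m n : ℕ) (a b : TensorAlgebra k V) :
    bracket k V m n a b = a * b - (-1 : k) ^ (m * n) • (b * a) := by
  simp [bracket]

variable {k V} in
/-- `IsLie n a`: `a` is a homogeneous element of degree `n` of the graded Lie subalgebra `L(V)` of
the tensor algebra `T(V)` generated by `V` (that is, of the free graded Lie algebra on `V`). -/
inductive IsLie : ℕ → TensorAlgebra k V → Prop
  | gen (v : V) : IsLie 1 (TensorAlgebra.ι k v)
  | bracket {m n : ℕ} {a b : TensorAlgebra k V} (ha : IsLie m a) (hb : IsLie n b) :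
      IsLie (m + n) (bracket k V m n a b)
  | zero (n : ℕ) : IsLie n 0
  | add {n : ℕ} {a b : TensorAlgebra k V} (ha : IsLie n a) (hb : IsLie n b) : IsLie n (a + b)
  | smul {n : ℕ} (c : k) {a : TensorAlgebra k V} (ha : IsLie n a) : IsLie n (c • a)

/-- `L_n(V)`, the homogeneous component of degree `n` of the free graded Lie algebra `L(V)`. -/
def L (n : ℕ) : Submodule k (TensorAlgebra k V) where
  carrier := {a | IsLie n a}
  add_mem' := IsLie.add
  zero_mem' := IsLie.zero n
  smul_mem' c _ := IsLie.smul c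

/-- `∑_{i = 2}^{n - 2} [L_i(V), L_{n-i}(V)]`, where `[A, B]` is the span of all brackets
`[a, b]` with `a ∈ A`, `b ∈ B`. -/
def decomposables (n : ℕ) : Submodule k (TensorAlgebra k V) :=
  ⨆ i ∈ Finset.Icc 2 (n - 2), Submodule.map₂ (bracket k V i (n - i)) (L k V i) (L k V (n - i))

/-- `∑_{i = 2}^{n - 2} [L_i(V), L_{n-i}(V)]` as a submodule of `L_n(V)`. -/
def decomposablesIn (n : ℕ) : Submodule k (L k V n) :=
  (decomposables k V n).submoduleOf (L k V n)

/-- `L̄_n(V) = L_n(V) / ∑_{i = 2}^{n - 2} [L_i(V), L_{n-i}(V)]`. -/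
abbrev LBar (n : ℕ) : Type _ := L k V n ⧸ decomposablesIn k V n

theorem decomposables_le (n : ℕ) : decomposables k V n ≤ L k V n := by
  refine iSup₂_le fun i hi => Submodule.map₂_le.2 fun a ha b hb => ?_
  have h : i + (n - i) = n := by
    have := Finset.mem_Icc.1 hi
    omega
  have := IsLie.bracket (k := k) (V := V) ha hb
  rw [h] at this
  exact this

/-! ### The iterated bracket `β_n` -/

/-- The left-normed iterated bracket
`(x_1, …, x_n) ↦ [[⋯[[x_1, x_2], x_3], ⋯], x_n]`, as a multilinear map. -/
def iteratedBracket : (n : ℕ) → MultilinearMap k (fun _ : Fin n => V) (TensorAlgebra k V)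
  | 0 => 0
  | 1 => MultilinearMap.ofSubsingleton k V (TensorAlgebra k V) 0 (TensorAlgebra.ι k)
  | n + 2 => MultilinearMap.uncurryRight (M := fun _ : Fin (n + 2) => V)
      (((bracket k V (n + 1) 1).compl₂ (TensorAlgebra.ι k)).compMultilinearMap
        (iteratedBracket (n + 1)))

variable {k V} in
theorem iteratedBracket_one (x : Fin 1 → V) :
    iteratedBracket k V 1 x = TensorAlgebra.ι k (x 0) := rfl

variable {k V} in
theorem iteratedBracket_succ (n : ℕ) (x : Fin (n + 2) → V) :
    iteratedBracket k V (n + 2) x =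
      bracket k V (n + 1) 1 (iteratedBracket k V (n + 1) (fun i => x i.castSucc))
        (TensorAlgebra.ι k (x (Fin.last (n + 1)))) := rfl

variable {k V} in
theorem isLie_iteratedBracket : ∀ (n : ℕ) (x : Fin n → V), IsLie n (iteratedBracket k V n x)
  | 0, _ => IsLie.zero 0
  | 1, _ => IsLie.gen _
  | n + 2, _ => IsLie.bracket (isLie_iteratedBracket (n + 1) _) (IsLie.gen _)

/-- `β_n : V^{⊗ n} → L_n(V)`, `x_1 ⊗ ⋯ ⊗ x_n ↦ [[⋯[[x_1, x_2], x_3], ⋯], x_n]`, as a linear map. -/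
def betaLin (n : ℕ) : (⨂[k]^n V) →ₗ[k] L k V n :=
  PiTensorProduct.lift
    { toFun := fun x => ⟨iteratedBracket k V n x, isLie_iteratedBracket n x⟩
      map_update_add' := fun m i x y => Subtype.ext ((iteratedBracket k V n).map_update_add m i x y)
      map_update_smul' := fun m i c x =>
        Subtype.ext ((iteratedBracket k V n).map_update_smul m i c x) }

variable {k V} in
theorem betaLin_tprod (n : ℕ) (x : Fin n → V) :
    (betaLin k V n (PiTensorProduct.tprod k x) : TensorAlgebra k V) = iteratedBracket k V n x := by
  simp [betaLin]

/-! ### The actions of `GL(V)` -/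

/-- `GL(V)` acting on `V`. -/
def stdRep : Representation k (LinearMap.GeneralLinearGroup k V) V :=
  Units.coeHom (V →ₗ[k] V)

/-- `GL(V)` acting diagonally on `V^{⊗ n}`. -/
def tensorPowerRep (n : ℕ) : Representation k (LinearMap.GeneralLinearGroup k V) (⨂[k]^n V) where
  toFun g := PiTensorProduct.map fun _ => stdRep k V g
  map_one' := by
    rw [map_one]
    exact PiTensorProduct.map_one (R := k) (s := fun _ : Fin n => V)
  map_mul' g h := by
    simp only [map_mul]
    exact PiTensorProduct.map_mul _ _

/-- `GL(V)` acting diagonally on the exterior power `E_n(V) = Λ^n(V)`. -/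
def exteriorPowerRep (n : ℕ) :
    Representation k (LinearMap.GeneralLinearGroup k V) (⋀[k]^n V) where
  toFun g := exteriorPower.map n (stdRep k V g)
  map_one' := by
    rw [map_one]
    exact exteriorPower.map_id (R := k) (M := V) (n := n)
  map_mul' g h := by
    rw [map_mul]
    exact exteriorPower.map_comp (stdRep k V h) (stdRep k V g)

/-- `GL(V)` acting on the tensor algebra `T(V)` by algebra automorphisms. -/
def tensorAlgebraRep : Representation k (LinearMap.GeneralLinearGroup k V) (TensorAlgebra k V) where
  toFun g := (TensorAlgebra.lift k (TensorAlgebra.ι k ∘ₗ stdRep k V g)).toLinearMap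
  map_one' := by
    rw [map_one]
    have : TensorAlgebra.lift k (TensorAlgebra.ι k ∘ₗ (1 : Module.End k V))
        = AlgHom.id k (TensorAlgebra k V) := by
      ext v
      simp
    rw [this]
    rfl
  map_mul' g h := by
    have : TensorAlgebra.lift k (TensorAlgebra.ι k ∘ₗ stdRep k V (g * h))
        = (TensorAlgebra.lift k (TensorAlgebra.ι k ∘ₗ stdRep k V g)).comp
          (TensorAlgebra.lift k (TensorAlgebra.ι k ∘ₗ stdRep k V h)) := by
      ext v
      simp
    rw [this]
    rfl

variable {k V} in
theorem tensorAlgebraRep_ι (g : LinearMap.GeneralLinearGroup k V) (v : V) :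
    tensorAlgebraRep k V g (TensorAlgebra.ι k v) = TensorAlgebra.ι k (stdRep k V g v) := by
  simp [tensorAlgebraRep]

variable {k V} in
theorem tensorAlgebraRep_bracket (g : LinearMap.GeneralLinearGroup k V) (m n : ℕ)
    (a b : TensorAlgebra k V) :
    tensorAlgebraRep k V g (bracket k V m n a b) =
      bracket k V m n (tensorAlgebraRep k V g a) (tensorAlgebraRep k V g b) := by
  simp [bracket_apply, tensorAlgebraRep]

variable {k V} in
theorem IsLie.map (g : LinearMap.GeneralLinearGroup k V) {n : ℕ} {a : TensorAlgebra k V}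
    (ha : IsLie n a) : IsLie n (tensorAlgebraRep k V g a) := by
  induction ha with
  | gen v => rw [tensorAlgebraRep_ι]; exact .gen _
  | bracket _ _ iha ihb => rw [tensorAlgebraRep_bracket]; exact .bracket iha ihb
  | zero n => rw [map_zero]; exact .zero n
  | add _ _ iha ihb => rw [map_add]; exact .add iha ihb
  | smul c _ ih => rw [map_smul]; exact .smul c ih

/-- `GL(V)` acting on `L_n(V)`. -/
def LRep (n : ℕ) : Representation k (LinearMap.GeneralLinearGroup k V) (L k V n) :=
  (tensorAlgebraRep k V).subrepresentation (L k V n) fun g _ ha => IsLie.map g ha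

variable {k V} in
theorem decomposables_map (g : LinearMap.GeneralLinearGroup k V) (n : ℕ) :
    decomposables k V n ≤ (decomposables k V n).comap (tensorAlgebraRep k V g) := by
  refine iSup₂_le fun i hi => Submodule.map₂_le.2 fun a ha b hb => ?_
  rw [Submodule.mem_comap, tensorAlgebraRep_bracket]
  exact Submodule.mem_iSup_of_mem i (Submodule.mem_iSup_of_mem hi
    (Submodule.apply_mem_map₂ _ (IsLie.map g ha) (IsLie.map g hb)))

/-- `GL(V)` acting on `L̄_n(V)`. -/
def LBarRep (n : ℕ) : Representation k (LinearMap.GeneralLinearGroup k V) (LBar k V n) :=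
  (LRep k V n).quotient (decomposablesIn k V n) fun g _ ha => decomposables_map g n ha

variable {k V} in
theorem iteratedBracket_map (g : LinearMap.GeneralLinearGroup k V) :
    ∀ (n : ℕ) (x : Fin n → V), tensorAlgebraRep k V g (iteratedBracket k V n x) =
      iteratedBracket k V n (fun i => stdRep k V g (x i))
  | 0, _ => map_zero _
  | 1, _ => tensorAlgebraRep_ι _ _
  | n + 2, x => by
    rw [iteratedBracket_succ, iteratedBracket_succ, tensorAlgebraRep_bracket,
      iteratedBracket_map g (n + 1), tensorAlgebraRep_ι]

/-- The `GL(V)`-map `β_n : V^{⊗ n} → L_n(V)`. -/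
def beta (n : ℕ) : (tensorPowerRep k V n).IntertwiningMap (LRep k V n) where
  toLinearMap := betaLin k V n
  isIntertwining' g := by
    refine PiTensorProduct.ext (MultilinearMap.ext fun x => Subtype.ext ?_)
    change (betaLin k V n (PiTensorProduct.map (fun _ => stdRep k V g)
        (PiTensorProduct.tprod k x)) : TensorAlgebra k V)
      = tensorAlgebraRep k V g (betaLin k V n (PiTensorProduct.tprod k x))
    rw [PiTensorProduct.map_tprod, betaLin_tprod, betaLin_tprod, iteratedBracket_map]

/-- The quotient `GL(V)`-map `L_n(V) → L̄_n(V)`. -/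
def toLBar (n : ℕ) : (LRep k V n).IntertwiningMap (LBarRep k V n) where
  toLinearMap := (decomposablesIn k V n).mkQ
  isIntertwining' _ := rfl

end OddLie

end

/-! Write p = m + 2, so V has a basis b_0, …, b_m, and put vol = b_0 ∧ ⋯ ∧ b_m.

The isomorphism. By the graded Jacobi identity left-normed brackets span L_n, so β_n is onto
(`beta_surjective`). Modulo decomposables the operators [-, x] anticommute on elements of degree at
least 2, and 2[[x, y], y] = -[[y, y], x]; hence L̄_p is spanned by the m + 1 brackets starting with
[b_i, b_i] and continuing through the other basis vectors (`L_le_sup_span_hookBracket`). The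
Fox-type derivative x_1 ⋯ x_n ↦ x_1 ⊗ (x_2 ∧ ⋯ ∧ x_n) kills decomposables, because Lie elements of
degree other than 1 vanish in Λ(V). It sends the spanning brackets to ±2 b_i ⊗ vol, a basis of the
target (`barToHook_bijective`).

No section. A section would send b_0 ⊗ vol to a tensor t fixed by all transvections b_j ↦ b_j + s
b_0. Let P(a, b) be the signed sum of the coefficients of t at the words in 0, 0, 1, …, m with the
zeros in positions a and b. Then P is antisymmetric, and invariance gives P(a, b) + P(b, c) + P(c,
a) = 0. Hence F(a) = ∑_b P(a, b) satisfies F(a) - F(c) = p P(a, c) = 0 (`IsPrimitive.firstSum_eq`).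
The b_0-coordinate of the image of t is F(0) - F(1), so it vanishes; invariance kills the other
coordinates. Thus t already dies in L̄_p, whichever isomorphism follows (`toLBar_beta_eq_zero`). -/

namespace OddLie

noncomputable section

/-! ### Left-normed brackets span the free graded Lie algebra -/

variable {k : Type*} [Field k] {V : Type*} [AddCommGroup V] [Module k V]

/-- The graded Jacobi identity. -/
theorem bracket_bracket (l m n : ℕ) (a b c : TensorAlgebra k V) :
    bracket k V l (m + n) a (bracket k V m n b c) =
      bracket k V (l + m) n (bracket k V l m a b) c -
        (-1 : k) ^ (m * n) • bracket k V (l + n) m (bracket k V l n a c) b := by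
  simp only [bracket_apply, mul_add, add_mul, pow_add, mul_comm n m]
  have h : ((-1 : k) ^ (m * n)) * (-1) ^ (m * n) = 1 := by
    rw [← mul_pow]; simp
  generalize (-1 : k) ^ (m * n) = s at *
  generalize (-1 : k) ^ (l * n) = t at *
  generalize (-1 : k) ^ (l * m) = r at *
  simp only [mul_sub, sub_mul, smul_sub, mul_smul_comm, smul_mul_assoc, smul_smul, mul_assoc]
  have h2 : s * (r * s) = r := by linear_combination r * h
  have h3 : s * (r * (s * t)) = r * t := by linear_combination r * t * h
  simp only [h2, h3]
  module

theorem IsLie.cast {m n : ℕ} (h : m = n) {a : TensorAlgebra k V} (ha : IsLie m a) : IsLie n a :=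
  h ▸ ha

variable (k V) in
/-- The span of the left-normed brackets of length `n`. -/
def leftNormed (n : ℕ) : Submodule k (TensorAlgebra k V) :=
  Submodule.span k (Set.range (iteratedBracket k V n))

theorem leftNormed_zero : leftNormed k V 0 = ⊥ := by
  rw [leftNormed, Submodule.span_eq_bot]
  rintro _ ⟨x, rfl⟩
  rfl

theorem bracket_gen_mem_leftNormed {n : ℕ} {a : TensorAlgebra k V} (ha : a ∈ leftNormed k V n)
    (v : V) : bracket k V n 1 a (TensorAlgebra.ι k v) ∈ leftNormed k V (n + 1) := by
  have : leftNormed k V n ≤ (leftNormed k V (n + 1)).comap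
      ((bracket k V n 1).flip (TensorAlgebra.ι k v)) := by
    refine Submodule.span_le.2 ?_
    rintro _ ⟨x, rfl⟩
    cases n with
    | zero =>
      have : iteratedBracket k V 0 x = 0 := rfl
      simp [this]
    | succ n =>
      refine Submodule.subset_span ⟨Fin.snoc (α := fun _ => V) x v, ?_⟩
      rw [iteratedBracket_succ]
      simp
  exact this ha

/-- Induction on the length of the right factor: Jacobi rewrites [a, [b, x]] as [[a, b], x] ± [[a,
x], b], whose inner right factors are all shorter. -/
theorem bracket_mem_leftNormed {n : ℕ} : ∀ {m : ℕ} {a b : TensorAlgebra k V},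
    a ∈ leftNormed k V m → b ∈ leftNormed k V n →
      bracket k V m n a b ∈ leftNormed k V (m + n) := by
  induction n with
  | zero =>
    intro m a b _ hb
    rw [leftNormed_zero, Submodule.mem_bot] at hb
    simp [hb]
  | succ n ih =>
    intro m a b ha hb
    have : leftNormed k V (n + 1) ≤ (leftNormed k V (m + (n + 1))).comap
        (bracket k V m (n + 1) a) := by
      refine Submodule.span_le.2 ?_
      rintro _ ⟨x, rfl⟩
      rw [SetLike.mem_coe, Submodule.mem_comap]
      cases n with
      | zero => exact bracket_gen_mem_leftNormed ha _
      | succ n =>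
        rw [iteratedBracket_succ, bracket_bracket]
        have hx : iteratedBracket k V (n + 1) (fun i => x i.castSucc) ∈ leftNormed k V (n + 1) :=
          Submodule.subset_span ⟨_, rfl⟩
        refine Submodule.sub_mem _ (bracket_gen_mem_leftNormed (ih ha hx) _)
          (Submodule.smul_mem _ _ ?_)
        have := ih (bracket_gen_mem_leftNormed ha (x (Fin.last (n + 1)))) hx
        rwa [show m + 1 + (n + 1) = m + (n + 1 + 1) by omega] at this
    exact this hb

theorem leftNormed_eq_L (n : ℕ) : leftNormed k V n = L k V n := by
  refine le_antisymm (Submodule.span_le.2 ?_) fun a (ha : IsLie n a) => ?_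
  · rintro _ ⟨x, rfl⟩
    exact isLie_iteratedBracket n x
  · induction ha with
    | gen v => exact Submodule.subset_span ⟨fun _ => v, rfl⟩
    | bracket _ _ iha ihb => exact bracket_mem_leftNormed iha ihb
    | zero n => exact zero_mem _
    | add _ _ iha ihb => exact add_mem iha ihb
    | smul c _ ih => exact Submodule.smul_mem _ c ih

theorem beta_surjective (n : ℕ) : Function.Surjective (beta k V n) := by
  have h : (LinearMap.range (betaLin k V n)).map (L k V n).subtype = L k V n := by
    refine le_antisymm (Submodule.map_subtype_le _ _) ((leftNormed_eq_L n).ge.trans ?_)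
    refine Submodule.span_le.2 ?_
    rintro _ ⟨x, rfl⟩
    exact ⟨_, ⟨PiTensorProduct.tprod k x, rfl⟩, betaLin_tprod n x⟩
  intro a
  obtain ⟨_, ⟨t, rfl⟩, ht⟩ := h.ge a.2
  exact ⟨t, Subtype.ext ht⟩

/-! ### Iterated brackets along a list -/

/-- `u ↦ [⋯[[u, x_1], x_2], ⋯, x_n]` for `u` of degree `r`. -/
def adList : ℕ → List V → TensorAlgebra k V →ₗ[k] TensorAlgebra k V
  | _, [] => LinearMap.id
  | r, x :: l => adList (r + 1) l ∘ₗ (bracket k V r 1).flip (TensorAlgebra.ι k x)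

theorem adList_cons (r : ℕ) (x : V) (l : List V) (u : TensorAlgebra k V) :
    adList r (x :: l) u = adList (r + 1) l (bracket k V r 1 u (TensorAlgebra.ι k x)) := rfl

theorem adList_concat (l : List V) : ∀ (r : ℕ) (x : V) (u : TensorAlgebra k V),
    adList r (l ++ [x]) u = bracket k V (r + l.length) 1 (adList r l u) (TensorAlgebra.ι k x) := by
  induction l with
  | nil => intros; rfl
  | cons y l ih =>
    intro r x u
    rw [List.cons_append, adList_cons, ih, adList_cons, List.length_cons,
      show r + 1 + l.length = r + (l.length + 1) by omega]

theorem IsLie.adList (l : List V) : ∀ {r : ℕ} {u : TensorAlgebra k V}, IsLie r u →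
    IsLie (r + l.length) (adList r l u) := by
  induction l with
  | nil => exact fun h => h
  | cons x l ih =>
    intro r u hu
    exact (ih (hu.bracket (.gen x))).cast (by simp; omega)

theorem iteratedBracket_eq_adList (n : ℕ) (x : Fin (n + 1) → V) :
    iteratedBracket k V (n + 1) x =
      adList 1 (List.ofFn fun i : Fin n => x i.succ) (TensorAlgebra.ι k (x 0)) := by
  induction n with
  | zero => rfl
  | succ n ih =>
    rw [iteratedBracket_succ, ih, List.ofFn_succ', List.concat_eq_append, adList_concat]
    simp [add_comm 1 n]

theorem iteratedBracket_eq_adList_two (n : ℕ) (x : Fin (n + 2) → V) :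
    iteratedBracket k V (n + 2) x =
      adList 2 (List.ofFn fun i : Fin n => x i.succ.succ)
        (bracket k V 1 1 (TensorAlgebra.ι k (x 0)) (TensorAlgebra.ι k (x 1))) := by
  rw [iteratedBracket_eq_adList, List.ofFn_succ, adList_cons]
  rfl

/-! ### Brackets modulo decomposables -/

theorem bracket_mem_decomposables {l m n : ℕ} (hl : 2 ≤ l) (hm : 2 ≤ m) (h : l + m = n)
    {a b : TensorAlgebra k V} (ha : IsLie l a) (hb : IsLie m b) :
    bracket k V l m a b ∈ decomposables k V n := by
  obtain rfl : m = n - l := by omega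
  exact Submodule.mem_iSup_of_mem l (Submodule.mem_iSup_of_mem
    (Finset.mem_Icc.2 ⟨hl, by omega⟩) (Submodule.apply_mem_map₂ _ ha hb))

/-- Up to sign [-, x] is a derivation, and it only lengthens one of two factors that already have
length at least 2. -/
theorem bracket_gen_mem_decomposables {n : ℕ} {u : TensorAlgebra k V}
    (hu : u ∈ decomposables k V n) (x : V) :
    bracket k V n 1 u (TensorAlgebra.ι k x) ∈ decomposables k V (n + 1) := by
  have : decomposables k V n ≤ (decomposables k V (n + 1)).comap
      ((bracket k V n 1).flip (TensorAlgebra.ι k x)) := by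
    refine iSup₂_le fun i hi => Submodule.map₂_le.2 fun a ha b hb => ?_
    have hi := Finset.mem_Icc.1 hi
    obtain ⟨j, rfl⟩ : ∃ j, n = i + j := ⟨n - i, by omega⟩
    rw [Nat.add_sub_cancel_left] at hb ⊢
    rw [Submodule.mem_comap, LinearMap.flip_apply,
      sub_eq_iff_eq_add.1 (bracket_bracket i j 1 a b (TensorAlgebra.ι k x)).symm]
    refine Submodule.add_mem _ ?_ (Submodule.smul_mem _ _ ?_)
    · exact bracket_mem_decomposables (by omega) (by omega) (by omega) ha (IsLie.bracket hb (.gen x))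
    · exact bracket_mem_decomposables (by omega) (by omega) (by omega) (IsLie.bracket ha (.gen x)) hb
  exact this hu

theorem adList_mem_decomposables (l : List V) : ∀ {r : ℕ} {u : TensorAlgebra k V},
    u ∈ decomposables k V r → adList r l u ∈ decomposables k V (r + l.length) := by
  induction l with
  | nil => exact fun h => h
  | cons x l ih =>
    intro r u hu
    have := ih (bracket_gen_mem_decomposables hu x)
    rwa [show r + 1 + l.length = r + (x :: l).length by simp; omega] at this

/-- Two operators `[-, x]` and `[-, y]` anticommute modulo decomposables. -/
theorem bracket_gen_gen_mem_decomposables {r : ℕ} (hr : 2 ≤ r) {u : TensorAlgebra k V}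
    (hu : IsLie r u) (x y : V) :
    bracket k V (r + 1) 1 (bracket k V r 1 u (TensorAlgebra.ι k x)) (TensorAlgebra.ι k y) +
      bracket k V (r + 1) 1 (bracket k V r 1 u (TensorAlgebra.ι k y)) (TensorAlgebra.ι k x) ∈
        decomposables k V (r + 2) := by
  have J := bracket_bracket r 1 1 u (TensorAlgebra.ι k x) (TensorAlgebra.ι k y)
  rw [mul_one, pow_one, neg_one_smul, sub_neg_eq_add] at J
  rw [← J]
  exact bracket_mem_decomposables hr le_rfl rfl hu (IsLie.bracket (.gen x) (.gen y))

/-- Modulo decomposables, the line spanned by an iterated bracket `[⋯[[u, x_1], x_2], ⋯, x_n]`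
does not depend on the order of the `x_i`. -/
theorem adList_mem_of_perm {l₁ l₂ : List V} (h : l₁.Perm l₂) : ∀ {r : ℕ}, 2 ≤ r →
    ∀ {u : TensorAlgebra k V}, IsLie r u → ∀ {S : Submodule k (TensorAlgebra k V)},
    decomposables k V (r + l₁.length) ≤ S → adList r l₁ u ∈ S → adList r l₂ u ∈ S := by
  induction h with
  | nil => exact fun _ _ _ _ _ h => h
  | @cons x l₁ l₂ _ ih =>
    intro r hr u hu S hS h
    refine ih (by omega : 2 ≤ r + 1) (hu.bracket (.gen x)) ?_ h
    rwa [show r + 1 + l₁.length = r + (x :: l₁).length by simp; omega]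
  | swap x y l =>
    intro r hr u hu S hS h
    have := hS (show r + (y :: x :: l).length = r + 2 + l.length by simp; omega ▸
      adList_mem_decomposables l (bracket_gen_gen_mem_decomposables hr hu x y))
    rw [map_add] at this
    exact (Submodule.add_mem_iff_left _ h).1 this
  | trans h₁ _ ih₁ ih₂ =>
    intro r hr u hu S hS h
    exact ih₂ hr hu (h₁.length_eq ▸ hS) (ih₁ hr hu hS h)

theorem bracket_gen_comm (x y : V) :
    bracket k V 1 1 (TensorAlgebra.ι k x) (TensorAlgebra.ι k y) =
      bracket k V 1 1 (TensorAlgebra.ι k y) (TensorAlgebra.ι k x) := by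
  simp [bracket_apply, add_comm]

/-- Jacobi only gives three times this, which is void in characteristic 3; the computation in the
tensor algebra covers that case as well. -/
theorem bracket_gen_self_self (x : V) :
    bracket k V 2 1 (bracket k V 1 1 (TensorAlgebra.ι k x) (TensorAlgebra.ι k x))
      (TensorAlgebra.ι k x) = 0 := by
  simp [bracket_apply, mul_assoc]

/-- The polarization of [[z, z], z] = 0. It moves a repeated letter into the two innermost slots. -/
theorem two_smul_bracket_gen (x y : V) :
    (2 : k) • bracket k V 2 1 (bracket k V 1 1 (TensorAlgebra.ι k x) (TensorAlgebra.ι k y))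
      (TensorAlgebra.ι k y) =
    - bracket k V 2 1 (bracket k V 1 1 (TensorAlgebra.ι k y) (TensorAlgebra.ι k y))
      (TensorAlgebra.ι k x) := by
  simp only [bracket_apply, mul_assoc, mul_sub, sub_mul, smul_sub,
    mul_smul_comm, smul_mul_assoc, smul_smul]
  norm_num
  module

/-- Move the two equal letters to the front: anticommutation of [-, x] with itself makes twice the
bracket decomposable, and 2 is invertible. -/
theorem adList_mem_decomposables_of_not_nodup (h2 : (2 : k) ≠ 0) {l : List V} (hl : ¬ l.Nodup)
    {r : ℕ} (hr : 2 ≤ r) {u : TensorAlgebra k V} (hu : IsLie r u) :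
    adList r l u ∈ decomposables k V (r + l.length) := by
  classical
  obtain ⟨x, hx⟩ := List.exists_duplicate_iff_not_nodup.2 hl
  obtain ⟨l', hl'⟩ : ∃ l', (x :: x :: l').Perm l := by
    have h1 := List.perm_cons_erase hx.mem
    have hm : x ∈ l.erase x := by
      rw [← List.count_pos_iff, List.count_erase_self]
      have := List.duplicate_iff_two_le_count.1 hx
      omega
    exact ⟨_, (h1.trans ((List.perm_cons_erase hm).cons x)).symm⟩
  refine adList_mem_of_perm hl' hr hu (by rw [hl'.length_eq]) ?_
  have := bracket_gen_gen_mem_decomposables hr hu x x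
  rw [← two_smul k, Submodule.smul_mem_iff _ h2] at this
  have := adList_mem_decomposables l' this
  rw [← hl'.length_eq]
  rwa [show r + 2 + l'.length = r + (x :: x :: l').length by simp; omega] at this

/-! ### A spanning set of the quotient by decomposables -/

section Spanning

variable {m : ℕ} (b : Fin (m + 1) → V)

/-- The list of all `b_j` with `j ≠ i`, in increasing order. -/
def others (i : Fin (m + 1)) : List V := List.ofFn fun j => b (i.succAbove j)

/-- The iterated bracket of `b_i`, `b_i` and all the other `b_j`. -/
def hookBracket (i : Fin (m + 1)) : TensorAlgebra k V :=
  adList 2 (others b i) (bracket k V 1 1 (TensorAlgebra.ι k (b i)) (TensorAlgebra.ι k (b i)))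

variable {b} in
theorem adList_self_mem {l : List (Fin (m + 1))} (h2 : (2 : k) ≠ 0) (hl : l.length = m)
    (i : Fin (m + 1)) :
    adList 2 (l.map b)
      (bracket k V 1 1 (TensorAlgebra.ι k (b i)) (TensorAlgebra.ι k (b i))) ∈
      decomposables k V (m + 2) ⊔ Submodule.span k (Set.range (hookBracket (k := k) b)) := by
  have hu : IsLie 2 (bracket k V 1 1 (TensorAlgebra.ι k (b i)) (TensorAlgebra.ι k (b i))) :=
    .bracket (.gen _) (.gen _)
  -- If i occurs in l, bringing it to the front produces [[b_i, b_i], b_i] = 0. Otherwise l either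
  -- repeats a letter or, having length m, is an ordering of all the other indices.
  by_cases hi : i ∈ l
  · have h := List.perm_cons_erase hi
    refine adList_mem_of_perm (h.map b).symm le_rfl hu ?_ ?_
    · rw [List.length_map, ← h.length_eq, hl, add_comm]
      exact le_sup_left
    · rw [List.map_cons, adList_cons, bracket_gen_self_self, map_zero]
      exact zero_mem _
  by_cases hd : l.Nodup
  · have h : (List.ofFn i.succAbove).Perm l := by
      refine (List.perm_ext_iff_of_nodup (List.nodup_ofFn.2 Fin.succAbove_right_injective) hd).2 ?_
      have hc : l.toFinset = {i}ᶜ := by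
        refine Finset.eq_of_subset_of_card_le ?_ ?_
        · intro j hj
          simp only [Finset.mem_compl, Finset.mem_singleton]
          rintro rfl
          exact hi (List.mem_toFinset.1 hj)
        · rw [List.toFinset_card_of_nodup hd, Finset.card_compl, hl]
          simp
      intro j
      rw [← List.mem_toFinset (l := l), hc]
      simp [List.mem_ofFn, Fin.exists_succAbove_eq_iff]
    refine adList_mem_of_perm (h.map b) le_rfl hu ?_ ?_
    · rw [List.length_map, List.length_ofFn, add_comm]
      exact le_sup_left
    · refine Submodule.mem_sup_right (Submodule.subset_span ⟨i, ?_⟩)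
      rw [hookBracket, others, List.map_ofFn]
      rfl
  · refine Submodule.mem_sup_left ?_
    have : ¬ (l.map b).Nodup := fun h => hd (h.of_map b)
    have := adList_mem_decomposables_of_not_nodup h2 this le_rfl hu
    rwa [List.length_map, hl, add_comm] at this

variable {b} in
theorem adList_mem_of_mem_right {l : List (Fin (m + 1))} (h2 : (2 : k) ≠ 0) (hl : l.length = m)
    (i : Fin (m + 1)) {j : Fin (m + 1)} (hj : j ∈ l) :
    adList 2 (l.map b)
      (bracket k V 1 1 (TensorAlgebra.ι k (b i)) (TensorAlgebra.ι k (b j))) ∈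
      decomposables k V (m + 2) ⊔ Submodule.span k (Set.range (hookBracket (k := k) b)) := by
  have h := List.perm_cons_erase hj
  refine adList_mem_of_perm (h.map b).symm le_rfl (.bracket (.gen _) (.gen _)) ?_ ?_
  · rw [List.length_map, ← h.length_eq, hl, add_comm]
    exact le_sup_left
  · rw [List.map_cons, adList_cons, ← Submodule.smul_mem_iff _ h2, ← map_smul,
      two_smul_bracket_gen, map_neg, Submodule.neg_mem_iff, ← adList_cons, ← List.map_cons]
    exact adList_self_mem (k := k) (b := b) (l := i :: l.erase j) h2 (h.length_eq.symm.trans hl) j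

variable {b} in
theorem adList_basis_mem {l : List (Fin (m + 1))} (h2 : (2 : k) ≠ 0) (hl : l.length = m)
    (i j : Fin (m + 1)) :
    adList 2 (l.map b)
      (bracket k V 1 1 (TensorAlgebra.ι k (b i)) (TensorAlgebra.ι k (b j))) ∈
      decomposables k V (m + 2) ⊔ Submodule.span k (Set.range (hookBracket (k := k) b)) := by
  by_cases hij : i = j
  · exact hij ▸ adList_self_mem h2 hl i
  by_cases hj : j ∈ l
  · exact adList_mem_of_mem_right h2 hl i hj
  by_cases hi : i ∈ l
  · rw [bracket_gen_comm]
    exact adList_mem_of_mem_right h2 hl j hi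
  by_cases hd : l.Nodup
  -- Pigeonhole: these would be m + 2 distinct indices among m + 1.
  · have : (i :: j :: l).Nodup := by simp [*]
    have := this.length_le_card
    simp [hl] at this
  · refine Submodule.mem_sup_left ?_
    have : ¬ (l.map b).Nodup := fun h => hd (h.of_map b)
    have := adList_mem_decomposables_of_not_nodup (k := k) h2 this le_rfl
      (.bracket (.gen (b i)) (.gen (b j)))
    rwa [List.length_map, hl, add_comm] at this

/-- `L_{m+2}(V)` is spanned, modulo decomposables, by the `m + 1` brackets `hookBracket b i`, if
`b` is a basis of `V`. -/
theorem L_le_sup_span_hookBracket (h2 : (2 : k) ≠ 0) (b : Module.Basis (Fin (m + 1)) k V) :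
    L k V (m + 2) ≤
      decomposables k V (m + 2) ⊔ Submodule.span k (Set.range (hookBracket (k := k) b)) := by
  set S := decomposables k V (m + 2) ⊔ Submodule.span k (Set.range (hookBracket (k := k) b))
    with hS
  have h0 : S.mkQ.compMultilinearMap (iteratedBracket k V (m + 2)) = 0 := by
    refine Module.Basis.ext_multilinear (fun _ => b) fun w => ?_
    rw [LinearMap.compMultilinearMap_apply, zero_apply, Submodule.mkQ_apply,
      Submodule.Quotient.mk_eq_zero, iteratedBracket_eq_adList_two]
    have := adList_basis_mem (b := b) (l := List.ofFn fun i : Fin m => w i.succ.succ) h2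
      (List.length_ofFn) (w 0) (w 1)
    rwa [List.map_ofFn] at this
  rw [← leftNormed_eq_L]
  refine Submodule.span_le.2 ?_
  rintro _ ⟨x, rfl⟩
  have := DFunLike.congr_fun h0 x
  rwa [LinearMap.compMultilinearMap_apply, zero_apply, Submodule.mkQ_apply,
      Submodule.Quotient.mk_eq_zero] at this

end Spanning

end

end OddLie

namespace OddLie

noncomputable section

variable {k : Type*} [Field k] {V : Type*} [AddCommGroup V] [Module k V]

/-! ### The Fox derivative -/

variable (k V) in
/-- Right multiplication by elements of `Λ(V)` on `V ⊗ Λ(V)`. -/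
def wedgeRight : ExteriorAlgebra k V →ₗ[k] Module.End k (V ⊗[k] ExteriorAlgebra k V) :=
  LinearMap.lTensorHom V ∘ₗ (LinearMap.mul k (ExteriorAlgebra k V)).flip

theorem wedgeRight_tmul (a : ExteriorAlgebra k V) (v : V) (b : ExteriorAlgebra k V) :
    wedgeRight k V a (v ⊗ₜ b) = v ⊗ₜ (b * a) := rfl

theorem wedgeRight_one : wedgeRight k V 1 = 1 :=
  TensorProduct.ext' fun v b => by simp [wedgeRight_tmul]

theorem wedgeRight_mul (a b : ExteriorAlgebra k V) :
    wedgeRight k V (a * b) = wedgeRight k V b ∘ₗ wedgeRight k V a :=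
  TensorProduct.ext' fun v c => by simp [wedgeRight_tmul, mul_assoc]

variable (k V) in
/-- The right action of `v` on `k × (V ⊗ Λ(V))`, `(c, m) ↦ (0, c (v ⊗ 1) + m v)`. -/
def foxStep : V →ₗ[k] (Module.End k (k × (V ⊗[k] ExteriorAlgebra k V)))ᵐᵒᵖ where
  toFun v := MulOpposite.op (LinearMap.inr k k (V ⊗[k] ExteriorAlgebra k V) ∘ₗ
    (LinearMap.toSpanSingleton k _ (v ⊗ₜ[k] (1 : ExteriorAlgebra k V))).coprod
      (wedgeRight k V (ExteriorAlgebra.ι k v)))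
  map_add' v w := by
    refine MulOpposite.unop_injective (LinearMap.ext fun x => ?_)
    simp only [TensorProduct.add_tmul, map_add, MulOpposite.unop_op, MulOpposite.unop_add,
      LinearMap.comp_apply, LinearMap.coprod_apply, LinearMap.toSpanSingleton_apply,
      LinearMap.add_apply, smul_add]
    abel
  map_smul' c v := by
    refine MulOpposite.unop_injective (LinearMap.ext fun x => ?_)
    simp [← TensorProduct.smul_tmul', map_smul, smul_comm c]

variable (k V) in
/-- The right action of the tensor algebra on `k × (V ⊗ Λ(V))` extending `foxStep`. -/
def foxAction : TensorAlgebra k V →ₐ[k] (Module.End k (k × (V ⊗[k] ExteriorAlgebra k V)))ᵐᵒᵖ :=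
  TensorAlgebra.lift k (foxStep k V)

theorem foxAction_ι (v : V) (x : k × (V ⊗[k] ExteriorAlgebra k V)) :
    (foxAction k V (TensorAlgebra.ι k v)).unop x =
      (0, x.1 • (v ⊗ₜ[k] 1) +
        wedgeRight k V (ExteriorAlgebra.ι k v) x.2) := by
  simp [foxAction, foxStep]

theorem foxAction_mul (a b : TensorAlgebra k V) (x : k × (V ⊗[k] ExteriorAlgebra k V)) :
    (foxAction k V (a * b)).unop x = (foxAction k V b).unop ((foxAction k V a).unop x) := by
  simp

/-- The scalar coordinate marks that no letter has been read yet. Once it is 0, the first letter has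
been stored in the V-factor and later letters act by exterior multiplication alone. -/
theorem foxAction_zero_prod (a : TensorAlgebra k V) :
    ∀ x : V ⊗[k] ExteriorAlgebra k V, (foxAction k V a).unop (0, x) =
      (0, wedgeRight k V (TensorAlgebra.toExterior a) x) := by
  induction a using TensorAlgebra.induction with
  | algebraMap c =>
    intro x
    rw [AlgHom.commutes, AlgHom.commutes]
    simp [Algebra.algebraMap_eq_smul_one, wedgeRight_one]
  | ι v => intro x; rw [foxAction_ι]; simp
  | mul a b iha ihb =>
    intro x
    rw [foxAction_mul, iha, ihb, map_mul, wedgeRight_mul]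
    rfl
  | add a b iha ihb =>
    intro x
    rw [map_add, MulOpposite.unop_add, LinearMap.add_apply, iha, ihb, map_add, map_add,
      LinearMap.add_apply, Prod.mk_add_mk, add_zero]

theorem foxAction_fst (a : TensorAlgebra k V) :
    ∀ x : k × (V ⊗[k] ExteriorAlgebra k V), ((foxAction k V a).unop x).1 =
      TensorAlgebra.algebraMapInv a * x.1 := by
  induction a using TensorAlgebra.induction with
  | algebraMap c =>
    intro x
    rw [AlgHom.commutes, AlgHom.commutes]
    simp [Algebra.algebraMap_eq_smul_one]
  | ι v => intro x; rw [foxAction_ι]; simp [TensorAlgebra.algebraMapInv]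
  | mul a b iha ihb =>
    intro x
    rw [foxAction_mul, ihb, iha, map_mul]
    ring
  | add a b iha ihb =>
    intro x
    rw [map_add, MulOpposite.unop_add, LinearMap.add_apply, Prod.fst_add, iha, ihb, map_add]
    ring

variable (k V) in
/-- The map `D : T(V) → V ⊗ Λ(V)`, `x_1 ⋯ x_n ↦ x_1 ⊗ (x_2 ∧ ⋯ ∧ x_n)`. -/
def fox : TensorAlgebra k V →ₗ[k] V ⊗[k] ExteriorAlgebra k V :=
  LinearMap.snd k k _ ∘ₗ LinearMap.applyₗ (1, 0) ∘ₗ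
    (MulOpposite.opLinearEquiv k).symm.toLinearMap ∘ₗ (foxAction k V).toLinearMap

theorem fox_ι (v : V) : fox k V (TensorAlgebra.ι k v) = v ⊗ₜ 1 := by
  change ((foxAction k V (TensorAlgebra.ι k v)).unop (1, 0)).2 = _
  rw [foxAction_ι]
  simp

theorem fox_mul {a : TensorAlgebra k V} (ha : TensorAlgebra.algebraMapInv a = 0)
    (b : TensorAlgebra k V) :
    fox k V (a * b) =
      wedgeRight k V (TensorAlgebra.toExterior b) (fox k V a) := by
  change ((foxAction k V (a * b)).unop (1, 0)).2 = _
  rw [foxAction_mul]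
  have : (foxAction k V a).unop (1, 0) = (0, fox k V a) :=
    Prod.ext (by rw [foxAction_fst, ha, zero_mul]) rfl
  rw [this, foxAction_zero_prod]

theorem IsLie.algebraMapInv_eq_zero {n : ℕ} {a : TensorAlgebra k V} (ha : IsLie n a) :
    TensorAlgebra.algebraMapInv a = 0 := by
  induction ha with
  | gen v => simp [TensorAlgebra.algebraMapInv]
  | bracket _ _ iha ihb => simp [bracket_apply, iha, ihb]
  | zero n => exact map_zero _
  | add _ _ iha ihb => rw [map_add, iha, ihb, add_zero]
  | smul c _ ih => rw [map_smul, ih, smul_zero]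

/-- The exterior algebra is graded commutative, so graded brackets die there. The degree 1 clause is
carried along for the induction: brackets of two generators vanish because vectors anticommute. -/
theorem IsLie.toExterior {n : ℕ} {a : TensorAlgebra k V} (ha : IsLie n a) :
    (n = 1 → ∃ v, TensorAlgebra.toExterior a = ExteriorAlgebra.ι k v) ∧
      (n ≠ 1 → TensorAlgebra.toExterior a = 0) := by
  induction ha with
  | gen v => exact ⟨fun _ => ⟨v, by simp⟩, fun h => absurd rfl h⟩
  | @bracket m n a b ha hb iha ihb =>
    have h : TensorAlgebra.toExterior (OddLie.bracket k V m n a b) = 0 := by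
      rw [bracket_apply, map_sub, map_smul, map_mul, map_mul]
      by_cases hm : m = 1
      · by_cases hn : n = 1
        · obtain ⟨v, hv⟩ := iha.1 hm
          obtain ⟨w, hw⟩ := ihb.1 hn
          rw [hv, hw, hm, hn]
          simp
        · simp [ihb.2 hn]
      · simp [iha.2 hm]
    exact ⟨fun _ => ⟨0, by simpa using h⟩, fun _ => h⟩
  | zero n => exact ⟨fun _ => ⟨0, by simp⟩, fun _ => map_zero _⟩
  | add _ _ iha ihb =>
    refine ⟨fun h => ?_, fun h => by rw [map_add, iha.2 h, ihb.2 h, add_zero]⟩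
    obtain ⟨v, hv⟩ := iha.1 h
    obtain ⟨w, hw⟩ := ihb.1 h
    exact ⟨v + w, by rw [map_add, map_add, hv, hw]⟩
  | smul c _ ih =>
    refine ⟨fun h => ?_, fun h => by rw [map_smul, ih.2 h, smul_zero]⟩
    obtain ⟨v, hv⟩ := ih.1 h
    exact ⟨c • v, by rw [map_smul, map_smul, hv]⟩

/-- The term coming from b a is D(b) multiplied by the exterior image of a, which is zero because
the degree of a is not 1. -/
theorem fox_bracket {m n : ℕ} (hm : m ≠ 1) {a b : TensorAlgebra k V} (ha : IsLie m a)
    (hb : IsLie n b) : fox k V (bracket k V m n a b) =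
      wedgeRight k V (TensorAlgebra.toExterior b) (fox k V a) := by
  rw [bracket_apply, map_sub, map_smul, fox_mul ha.algebraMapInv_eq_zero,
    fox_mul hb.algebraMapInv_eq_zero, ha.toExterior.2 hm]
  simp

theorem fox_decomposables {n : ℕ} {a : TensorAlgebra k V} (ha : a ∈ decomposables k V n) :
    fox k V a = 0 := by
  have : decomposables k V n ≤ LinearMap.ker (fox k V) := by
    refine iSup₂_le fun i hi => Submodule.map₂_le.2 fun a ha b hb => ?_
    have hi := Finset.mem_Icc.1 hi
    rw [LinearMap.mem_ker, fox_bracket (by omega) ha hb, (IsLie.toExterior hb).2 (by omega)]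
    simp
  exact this ha

theorem fox_adList (l : List V) : ∀ {r : ℕ} (_ : 2 ≤ r) {u : TensorAlgebra k V} (_ : IsLie r u),
    fox k V (adList r l u) =
      wedgeRight k V (l.map (ExteriorAlgebra.ι k)).prod
        (fox k V u) := by
  induction l with
  | nil => intros; simp [adList, wedgeRight_one]
  | cons x l ih =>
    intro r hr u hu
    rw [adList_cons, ih (by omega) (hu.bracket (.gen x)), fox_bracket (by omega) hu (.gen x),
      List.map_cons, List.prod_cons, wedgeRight_mul]
    simp

theorem fox_bracket_gen_gen (x y : V) :
    fox k V (bracket k V 1 1 (TensorAlgebra.ι k x) (TensorAlgebra.ι k y)) =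
      x ⊗ₜ ExteriorAlgebra.ι k y + y ⊗ₜ ExteriorAlgebra.ι k x := by
  rw [bracket_apply, map_sub, map_smul, fox_mul (IsLie.gen x).algebraMapInv_eq_zero,
    fox_mul (IsLie.gen y).algebraMapInv_eq_zero, fox_ι, fox_ι]
  simp [wedgeRight_tmul]

variable (k V) in
/-- The projection of the exterior algebra onto its homogeneous component of degree `n`. -/
def exteriorProj (n : ℕ) : ExteriorAlgebra k V →ₗ[k] ⋀[k]^n V :=
  DirectSum.component k ℕ (fun i => ⋀[k]^i V) n ∘ₗ
    (DirectSum.decomposeLinearEquiv fun i => ⋀[k]^i V).toLinearMap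

theorem exteriorProj_ιMulti (n : ℕ) (x : Fin n → V) :
    exteriorProj k V n (ExteriorAlgebra.ιMulti k n x) = exteriorPower.ιMulti k n x := by
  have : DirectSum.decompose (fun i => ⋀[k]^i V) (ExteriorAlgebra.ιMulti k n x) =
      DirectSum.of (fun i => ⋀[k]^i V) n (exteriorPower.ιMulti k n x) :=
    DirectSum.decompose_coe (fun i => ⋀[k]^i V) (exteriorPower.ιMulti k n x)
  change DirectSum.decompose (fun i => ⋀[k]^i V) (ExteriorAlgebra.ιMulti k n x) n = _
  rw [this, DirectSum.of_eq_same]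

variable (k V) in
/-- The map `L_{m+2}(V) → V ⊗ Λ^{m+1}(V)` induced by the Fox derivative. -/
def toHook (m : ℕ) : L k V (m + 2) →ₗ[k] V ⊗[k] (⋀[k]^(m + 1) V) :=
  LinearMap.lTensor V (exteriorProj k V (m + 1)) ∘ₗ fox k V ∘ₗ (L k V (m + 2)).subtype

theorem toHook_iteratedBracket {m : ℕ} (x : Fin (m + 2) → V)
    (h : iteratedBracket k V (m + 2) x ∈ L k V (m + 2)) :
    toHook k V m ⟨iteratedBracket k V (m + 2) x, h⟩ =
      x 0 ⊗ₜ exteriorPower.ιMulti k (m + 1) (Fin.cons (x 1) fun i : Fin m => x i.succ.succ) +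
      x 1 ⊗ₜ exteriorPower.ιMulti k (m + 1) (Fin.cons (x 0) fun i : Fin m => x i.succ.succ) := by
  have h (y : V) : ExteriorAlgebra.ι k y * (List.map (ExteriorAlgebra.ι k)
      (List.ofFn fun i : Fin m => x i.succ.succ)).prod =
      ExteriorAlgebra.ιMulti k (m + 1) (Fin.cons y fun i : Fin m => x i.succ.succ) := by
    rw [ExteriorAlgebra.ιMulti_apply, List.ofFn_succ, List.prod_cons, List.map_ofFn]
    simp [Function.comp_def]
  change LinearMap.lTensor V (exteriorProj k V (m + 1))
    (fox k V (iteratedBracket k V (m + 2) x)) = _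
  rw [iteratedBracket_eq_adList_two, fox_adList _ le_rfl (.bracket (.gen _) (.gen _)),
    fox_bracket_gen_gen]
  simp only [map_add, wedgeRight_tmul, LinearMap.lTensor_tmul, h, exteriorProj_ιMulti]

variable (k V) in
/-- The map `L̄_{m+2}(V) → V ⊗ Λ^{m+1}(V)` induced by the Fox derivative. -/
def barToHook (m : ℕ) : LBar k V (m + 2) →ₗ[k] V ⊗[k] (⋀[k]^(m + 1) V) :=
  (decomposablesIn k V (m + 2)).liftQ (toHook k V m) fun a ha => by
    have : fox k V a = 0 := fox_decomposables ha
    simp [toHook, this]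

/-- The composite `V^{⊗(m+2)} → L_{m+2}(V) → L̄_{m+2}(V) → V ⊗ Λ^{m+1}(V)` on pure tensors. -/
theorem barToHook_toLBar_beta_tprod {m : ℕ} (x : Fin (m + 2) → V) :
    barToHook k V m (toLBar k V (m + 2) (beta k V (m + 2) (PiTensorProduct.tprod k x))) =
      x 0 ⊗ₜ exteriorPower.ιMulti k (m + 1) (Fin.cons (x 1) fun i : Fin m => x i.succ.succ) +
      x 1 ⊗ₜ exteriorPower.ιMulti k (m + 1) (Fin.cons (x 0) fun i : Fin m => x i.succ.succ) := by
  have : beta k V (m + 2) (PiTensorProduct.tprod k x) =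
      ⟨iteratedBracket k V (m + 2) x, isLie_iteratedBracket _ x⟩ :=
    Subtype.ext (betaLin_tprod _ x)
  rw [this]
  exact toHook_iteratedBracket x _

theorem toLBar_surjective (n : ℕ) : Function.Surjective (toLBar k V n) :=
  Submodule.mkQ_surjective _

theorem barToHook_equivariant (m : ℕ) (g : LinearMap.GeneralLinearGroup k V)
    (a : LBar k V (m + 2)) :
    barToHook k V m (LBarRep k V (m + 2) g a) =
      (stdRep k V).tprod (exteriorPowerRep k V (m + 1)) g (barToHook k V m a) := by
  obtain ⟨a, rfl⟩ := toLBar_surjective _ a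
  obtain ⟨t, rfl⟩ := beta_surjective _ a
  rw [← Representation.IntertwiningMap.isIntertwining,
    ← Representation.IntertwiningMap.isIntertwining]
  induction t using PiTensorProduct.induction_on with
  | smul_tprod c x =>
    have h : tensorPowerRep k V (m + 2) g (PiTensorProduct.tprod k x) =
        PiTensorProduct.tprod k fun i => stdRep k V g (x i) :=
      PiTensorProduct.map_tprod _ _
    have h' (y : Fin (m + 1) → V) : exteriorPowerRep k V (m + 1) g (exteriorPower.ιMulti k _ y) =
        exteriorPower.ιMulti k _ fun i => stdRep k V g (y i) :=
      exteriorPower.map_apply_ιMulti _ _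
    have hc (y : V) : (fun i => stdRep k V g
        ((Fin.cons y fun i : Fin m => x i.succ.succ : Fin (m + 1) → V) i)) =
        (Fin.cons (stdRep k V g y) fun i : Fin m => stdRep k V g (x i.succ.succ)) := by
      funext i
      refine Fin.cases ?_ (fun i => ?_) i <;> simp
    simp only [map_smul, h, barToHook_toLBar_beta_tprod, map_add, Representation.tprod_apply,
      TensorProduct.map_tmul, h', hc]
  | add s t hs ht => simp only [map_add, hs, ht]

end

end OddLie

namespace OddLie

noncomputable section

variable {k : Type*} [Field k] {V : Type*} [AddCommGroup V] [Module k V]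

/-! ### Coordinates on the target and the isomorphism -/

section Basis

variable {m : ℕ} (b : Module.Basis (Fin (m + 1)) k V)

/-- The linear functional `v ⊗ (y_0 ∧ ⋯ ∧ y_m) ↦ b_i^*(v) det(y_0, …, y_m)`. -/
def hookCoord (i : Fin (m + 1)) : V ⊗[k] (⋀[k]^(m + 1) V) →ₗ[k] k :=
  LinearMap.mul' k k ∘ₗ
    TensorProduct.map (b.coord i) (exteriorPower.alternatingMapLinearEquiv b.det)

theorem hookCoord_tmul_ιMulti (i : Fin (m + 1)) (v : V) (y : Fin (m + 1) → V) :
    hookCoord b i (v ⊗ₜ exteriorPower.ιMulti k (m + 1) y) = b.coord i v * b.det y := by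
  simp [hookCoord]

theorem ιMulti_eq_det_smul (y : Fin (m + 1) → V) :
    exteriorPower.ιMulti k (m + 1) y = b.det y • exteriorPower.ιMulti k (m + 1) b := by
  have : exteriorPower.ιMulti k (m + 1) =
      (LinearMap.toSpanSingleton k _ (exteriorPower.ιMulti k (m + 1) b)).compAlternatingMap
        b.det := by
    refine Module.Basis.ext_alternating b fun v hv => ?_
    obtain ⟨σ, rfl⟩ : ∃ σ : Equiv.Perm (Fin (m + 1)), ⇑σ = v :=
      ⟨Equiv.ofBijective v (Finite.injective_iff_bijective.1 hv), rfl⟩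
    have h1 := (exteriorPower.ιMulti k (m + 1)).map_perm b σ
    have h2 := b.det.map_perm b σ
    rw [Function.comp_def] at h1 h2
    rw [h1, LinearMap.compAlternatingMap_apply, h2, b.det_self]
    simp [Units.smul_def, Int.cast_smul_eq_zsmul]
  exact DFunLike.congr_fun this y

theorem sum_hookCoord_smul (z : V ⊗[k] (⋀[k]^(m + 1) V)) :
    ∑ i, hookCoord b i z • (b i ⊗ₜ[k] exteriorPower.ιMulti k (m + 1) b) = z := by
  have : ∑ i, (hookCoord b i).smulRight (b i ⊗ₜ[k] exteriorPower.ιMulti k (m + 1) b) =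
      LinearMap.id := by
    refine TensorProduct.ext (LinearMap.ext fun v => exteriorPower.linearMap_ext
      (AlternatingMap.ext fun y => ?_))
    simp only [LinearMap.compAlternatingMap_apply, LinearMap.compr₂ₛₗ_apply, TensorProduct.mk_apply,
      LinearMap.sum_apply, LinearMap.smulRight_apply, hookCoord_tmul_ιMulti, LinearMap.id_apply]
    rw [ιMulti_eq_det_smul b y, TensorProduct.tmul_smul]
    conv_rhs => rw [← b.sum_repr v, TensorProduct.sum_tmul, Finset.smul_sum]
    refine Finset.sum_congr rfl fun i _ => ?_
    rw [← TensorProduct.smul_tmul', smul_smul, mul_comm, Module.Basis.coord_apply]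
  simpa using DFunLike.congr_fun this z

theorem eq_zero_of_hookCoord_eq_zero {z : V ⊗[k] (⋀[k]^(m + 1) V)}
    (h : ∀ i, hookCoord b i z = 0) : z = 0 := by
  rw [← sum_hookCoord_smul b z]
  simp [h]

/-- The family is a permutation of the basis, so its determinant is ±1. -/
theorem det_cons_succAbove_ne_zero (i : Fin (m + 1)) :
    b.det (Fin.cons (b i) fun j : Fin m => b (i.succAbove j)) ≠ 0 := by
  have hv : Function.Injective (Fin.cons i i.succAbove : Fin (m + 1) → Fin (m + 1)) :=
    Fin.cons_injective_iff.2 ⟨by simp, Fin.succAbove_right_injective⟩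
  obtain ⟨σ, hσ⟩ : ∃ σ : Equiv.Perm (Fin (m + 1)), ⇑σ = Fin.cons i i.succAbove :=
    ⟨Equiv.ofBijective _ (Finite.injective_iff_bijective.1 hv), rfl⟩
  have : (Fin.cons (b i) fun j : Fin m => b (i.succAbove j) : Fin (m + 1) → V) = b ∘ σ := by
    rw [hσ]
    funext j
    refine Fin.cases ?_ (fun j => ?_) j <;> simp
  rw [this, b.det.map_perm, b.det_self]
  rcases Int.units_eq_one_or (Equiv.Perm.sign σ) with h | h <;> simp [h]

/-- The class of `hookBracket b i` in `L̄_{m+2}(V)`. -/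
def hookClass (i : Fin (m + 1)) : LBar k V (m + 2) :=
  toLBar k V (m + 2) (beta k V (m + 2) (PiTensorProduct.tprod k
    (Fin.cons (b i) (Fin.cons (b i) fun j : Fin m => b (i.succAbove j)) : Fin (m + 2) → V)))

theorem barToHook_hookClass (i : Fin (m + 1)) :
    barToHook k V m (hookClass b i) =
      (2 * b.det (Fin.cons (b i) fun j : Fin m => b (i.succAbove j))) •
        (b i ⊗ₜ exteriorPower.ιMulti k (m + 1) b) := by
  rw [hookClass, barToHook_toLBar_beta_tprod]
  simp only [Fin.cons_zero, Fin.cons_one, Fin.cons_succ]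
  rw [ιMulti_eq_det_smul b (Fin.cons (b i) _), TensorProduct.tmul_smul, ← two_smul k, smul_smul]

theorem exists_sum_hookClass (h2 : (2 : k) ≠ 0) (a : LBar k V (m + 2)) :
    ∃ c : Fin (m + 1) → k, a = ∑ i, c i • hookClass b i := by
  obtain ⟨⟨a, ha⟩, rfl⟩ := toLBar_surjective _ a
  obtain ⟨d, hd, s, hs, hds⟩ := Submodule.mem_sup.1 (L_le_sup_span_hookBracket h2 b ha)
  obtain ⟨c, rfl⟩ := (Submodule.mem_span_range_iff_exists_fun k).1 hs
  refine ⟨c, ?_⟩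
  have hb (i : Fin (m + 1)) : ((beta k V (m + 2) (PiTensorProduct.tprod k
      (Fin.cons (b i) (Fin.cons (b i) fun j : Fin m => b (i.succAbove j)) : Fin (m + 2) → V)) :
      L k V (m + 2)) : TensorAlgebra k V) = hookBracket b i := by
    refine (betaLin_tprod _ _).trans ?_
    rw [iteratedBracket_eq_adList_two]
    rfl
  simp only [hookClass, ← map_smul, ← map_sum]
  refine (Submodule.Quotient.eq _).2 ?_
  change (_ : TensorAlgebra k V) ∈ decomposables k V (m + 2)
  simp only [map_sum, map_smul, Submodule.subtype_apply, map_sub, hb]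
  rw [← hds, add_sub_cancel_right]
  exact hd

/-- A spanning family of the source goes to nonzero multiples of a basis of the target, so the
dimension of L̄ need not be known beforehand. -/
theorem barToHook_bijective (b : Module.Basis (Fin (m + 1)) k V) (h2 : (2 : k) ≠ 0) : Function.Bijective (barToHook k V m) := by
  have hu (i) := mul_ne_zero h2 (det_cons_succAbove_ne_zero b i)
  constructor
  · rw [← LinearMap.ker_eq_bot, LinearMap.ker_eq_bot']
    intro a ha
    obtain ⟨c, rfl⟩ := exists_sum_hookClass b h2 a
    refine Finset.sum_eq_zero fun i _ => ?_
    have := congrArg (hookCoord b i) ha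
    simp only [map_sum, map_smul, barToHook_hookClass, hookCoord_tmul_ιMulti, b.det_self, map_zero,
      smul_eq_mul, Module.Basis.coord_apply, b.repr_self, Finsupp.single_apply, mul_one, mul_ite,
      mul_zero, Finset.sum_ite_eq', Finset.mem_univ, if_true] at this
    rw [(mul_eq_zero.1 this).resolve_right (hu i), zero_smul]
  · rw [← LinearMap.range_eq_top, eq_top_iff]
    intro z _
    rw [← sum_hookCoord_smul b z]
    refine Submodule.sum_mem _ fun i _ => Submodule.smul_mem _ _ ?_
    rw [← Submodule.smul_mem_iff _ (hu i), ← barToHook_hookClass]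
    exact ⟨_, rfl⟩

/-- The isomorphism `L̄_{m+2}(V) ≅ V ⊗ Λ^{m+1}(V)` for `V` of dimension `m + 1`. -/
def barEquivHook (h2 : (2 : k) ≠ 0) :
    (LBarRep k V (m + 2)).Equiv ((stdRep k V).tprod (exteriorPowerRep k V (m + 1))) :=
  Representation.Equiv.mk (LinearEquiv.ofBijective _ (barToHook_bijective b h2)) fun g =>
    LinearMap.ext fun a => barToHook_equivariant m g a

end Basis

end

end OddLie

namespace OddLie

noncomputable section

/-! ### Signed sums over words -/

section Words

variable {k : Type*} [CommRing k] {m : ℕ}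

/-- The word in the letters `0, 0, 1, …, m`, with the letters placed according to `σ`. -/
def word (σ : Equiv.Perm (Fin (m + 2))) : Fin (m + 2) → Fin (m + 1) :=
  fun i => (Fin.cons 0 id : Fin (m + 2) → Fin (m + 1)) (σ⁻¹ i)

theorem word_apply (σ : Equiv.Perm (Fin (m + 2))) (i : Fin (m + 2)) :
    word σ (σ i) = (Fin.cons 0 id : Fin (m + 2) → Fin (m + 1)) i := by
  simp [word]

theorem word_mul (γ σ : Equiv.Perm (Fin (m + 2))) (i : Fin (m + 2)) :
    word (γ * σ) (γ i) = word σ i := by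
  simp [word, mul_inv_rev]

theorem word_mul_swap (σ : Equiv.Perm (Fin (m + 2))) :
    word (σ * Equiv.swap 0 1) = word σ := by
  funext i
  obtain ⟨i, rfl⟩ := (σ * Equiv.swap 0 1).surjective i
  rw [word_apply, Equiv.Perm.mul_apply, word_apply]
  refine Fin.cases ?_ (fun i => Fin.cases ?_ (fun i => ?_) i) i
  · rw [Equiv.swap_apply_left]
    rfl
  · rw [Fin.succ_zero_eq_one, Equiv.swap_apply_right]
    rfl
  · rw [Equiv.swap_apply_of_ne_of_ne (Fin.succ_ne_zero _) (Fin.succ_succ_ne_one i)]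

theorem word_ne_zero {σ : Equiv.Perm (Fin (m + 2))} {i : Fin (m + 2)} (h0 : σ 0 ≠ i)
    (h1 : σ 1 ≠ i) : word σ i ≠ 0 := by
  obtain ⟨i, rfl⟩ := σ.surjective i
  rw [word_apply]
  rw [Ne, σ.apply_eq_iff_eq] at h0 h1
  revert h0 h1
  refine Fin.cases (fun h => absurd rfl h) (fun i => ?_) i
  intro _ h h'
  rw [Fin.cons_succ, id] at h'
  exact h (by rw [h', Fin.succ_zero_eq_one])

variable (C : (Fin (m + 2) → Fin (m + 1)) → k)

/-- The signed sum of the values of `C` on all words that have the letters `0` in the positions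
`a` and `b`. -/
def pairSum (a b : Fin (m + 2)) : k :=
  ∑ σ : Equiv.Perm (Fin (m + 2)),
    if σ 0 = a ∧ σ 1 = b then (Equiv.Perm.sign σ : k) * C (word σ) else 0

/-- The signed sum of the values of `C` on all words with the first letter `0` in position `a`. -/
def firstSum (a : Fin (m + 2)) : k :=
  ∑ σ : Equiv.Perm (Fin (m + 2)), if σ 0 = a then (Equiv.Perm.sign σ : k) * C (word σ) else 0

theorem firstSum_eq_sum_pairSum (a : Fin (m + 2)) : firstSum C a = ∑ b, pairSum C a b := by
  simp only [firstSum, pairSum]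
  rw [Finset.sum_comm]
  refine Finset.sum_congr rfl fun σ _ => ?_
  by_cases h : σ 0 = a <;> simp [h]

/-- Exchanging the two letters 0 leaves the word unchanged and reverses the sign of the permutation.
-/
theorem pairSum_swap (a b : Fin (m + 2)) : pairSum C b a = - pairSum C a b := by
  rw [pairSum, pairSum, ← Equiv.sum_comp (Equiv.mulRight (Equiv.swap 0 1)),
    ← Finset.sum_neg_distrib]
  refine Finset.sum_congr rfl fun σ _ => ?_
  have h01 : (0 : Fin (m + 2)) ≠ 1 := by simp
  simp only [Equiv.coe_mulRight, Equiv.Perm.mul_apply, Equiv.swap_apply_left,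
    Equiv.swap_apply_right, word_mul_swap, Equiv.Perm.sign_mul, Equiv.Perm.sign_swap h01]
  by_cases h : σ 0 = a ∧ σ 1 = b
  · simp [h]
  · rw [if_neg h, if_neg (fun h' => h h'.symm), neg_zero]

/-- `C` is annihilated by the operators that replace one of the letters `0` by `j`, on words with
exactly three letters `0`. -/
def IsPrimitive : Prop :=
  ∀ (u : Fin (m + 2) → Fin (m + 1)) (a b c : Fin (m + 2)) (j : Fin (m + 1)),
    a ≠ b → b ≠ c → a ≠ c → j ≠ 0 → (∀ i, u i = 0 ↔ i = a ∨ i = b ∨ i = c) →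
      C (Function.update u a j) + C (Function.update u b j) + C (Function.update u c j) = 0

variable {C}

theorem IsPrimitive.pairSum_add_pairSum_add_pairSum (hC : IsPrimitive C) {a b c : Fin (m + 2)}
    (hab : a ≠ b) (hbc : b ≠ c) (hac : a ≠ c) :
    pairSum C a b + pairSum C b c + pairSum C c a = 0 := by
  -- The 3-cycle a → b → c → a is even, so translating by it turns all three sums into sums over the
  -- same permutations with the same signs.
  set γ : Equiv.Perm (Fin (m + 2)) := Equiv.swap a b * Equiv.swap b c with hγ
  have ha : γ a = b := by
    rw [hγ, Equiv.Perm.mul_apply, Equiv.swap_apply_of_ne_of_ne hab hac, Equiv.swap_apply_left]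
  have hb : γ b = c := by
    rw [hγ, Equiv.Perm.mul_apply, Equiv.swap_apply_left,
      Equiv.swap_apply_of_ne_of_ne hac.symm hbc.symm]
  have hc : γ c = a := by
    rw [hγ, Equiv.Perm.mul_apply, Equiv.swap_apply_right, Equiv.swap_apply_right]
  have hd {d} (h1 : d ≠ a) (h2 : d ≠ b) (h3 : d ≠ c) : γ d = d := by
    rw [hγ, Equiv.Perm.mul_apply, Equiv.swap_apply_of_ne_of_ne h2 h3,
      Equiv.swap_apply_of_ne_of_ne h1 h2]
  have hs : Equiv.Perm.sign γ = 1 := by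
    rw [hγ, Equiv.Perm.sign_mul, Equiv.Perm.sign_swap hab, Equiv.Perm.sign_swap hbc]
    simp
  have e1 {x y : Fin (m + 2)} : γ x = γ y ↔ x = y := γ.apply_eq_iff_eq
  have hbc' : pairSum C b c = ∑ σ : Equiv.Perm (Fin (m + 2)), if σ 0 = a ∧ σ 1 = b then
      (Equiv.Perm.sign σ : k) * C (word (γ * σ)) else 0 := by
    rw [pairSum, ← Equiv.sum_comp (Equiv.mulLeft γ)]
    refine Finset.sum_congr rfl fun σ _ => ?_
    simp only [Equiv.coe_mulLeft, Equiv.Perm.mul_apply, map_mul, hs, one_mul]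
    have h0 : γ (σ 0) = b ↔ σ 0 = a := by conv_lhs => rw [← ha, e1]
    have h1 : γ (σ 1) = c ↔ σ 1 = b := by conv_lhs => rw [← hb, e1]
    simp only [h0, h1]
  have hca' : pairSum C c a = ∑ σ : Equiv.Perm (Fin (m + 2)), if σ 0 = a ∧ σ 1 = b then
      (Equiv.Perm.sign σ : k) * C (word (γ * (γ * σ))) else 0 := by
    rw [pairSum, ← Equiv.sum_comp (Equiv.mulLeft γ), ← Equiv.sum_comp (Equiv.mulLeft γ)]
    refine Finset.sum_congr rfl fun σ _ => ?_
    simp only [Equiv.coe_mulLeft, Equiv.Perm.mul_apply, map_mul, hs, one_mul]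
    have h0 : γ (γ (σ 0)) = c ↔ σ 0 = a := by conv_lhs => rw [← hb, e1, ← ha, e1]
    have h1 : γ (γ (σ 1)) = a ↔ σ 1 = b := by conv_lhs => rw [← hc, e1, ← hb, e1]
    simp only [h0, h1]
  rw [hbc', hca', pairSum, ← Finset.sum_add_distrib, ← Finset.sum_add_distrib]
  refine Finset.sum_eq_zero fun σ _ => ?_
  split_ifs with h
  swap
  · simp
  obtain ⟨h0, h1⟩ := h
  have wa : word σ a = 0 := by rw [← h0, word_apply]; rfl
  have wb : word σ b = 0 := by rw [← h1, word_apply, ← Fin.succ_zero_eq_one]; rfl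
  have wd {d} (h2 : d ≠ a) (h3 : d ≠ b) : word σ d ≠ 0 :=
    word_ne_zero (by rw [h0]; exact h2.symm) (by rw [h1]; exact h3.symm)
  -- Writing 0 in position c gives a word with exactly three zeros. Putting the displaced letter
  -- back at c, a or b recovers the three words being compared.
  have key := hC (Function.update (word σ) c 0) a b c (word σ c) hab hbc hac
    (wd hac.symm hbc.symm) fun i => by
      by_cases hic : i = c
      · simp [hic]
      rw [Function.update_of_ne hic]
      by_cases hia : i = a
      · simp [hia, wa]
      by_cases hib : i = b
      · simp [hib, wb]
      simp [hia, hib, hic, wd hia hib]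
  have k1 : word σ = Function.update (Function.update (word σ) c 0) c (word σ c) := by simp
  have k2 : word (γ * σ) = Function.update (Function.update (word σ) c 0) a (word σ c) := by
    funext i
    obtain ⟨i, rfl⟩ := γ.surjective i
    rw [word_mul]
    by_cases hia : i = a
    · rw [hia, ha, Function.update_of_ne hab.symm, Function.update_of_ne hbc, wa, wb]
    by_cases hib : i = b
    · rw [hib, hb, Function.update_of_ne hac.symm, Function.update_self, wb]
    by_cases hic : i = c
    · rw [hic, hc, Function.update_self]
    rw [hd hia hib hic, Function.update_of_ne hia, Function.update_of_ne hic]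
  have k3 : word (γ * (γ * σ)) =
      Function.update (Function.update (word σ) c 0) b (word σ c) := by
    funext i
    obtain ⟨i, rfl⟩ := γ.surjective i
    rw [word_mul, k2]
    by_cases hia : i = a
    · rw [hia, ha, Function.update_self, Function.update_self]
    by_cases hib : i = b
    · rw [hib, hb, Function.update_of_ne hab.symm, Function.update_of_ne hbc,
        Function.update_of_ne hbc.symm, Function.update_self, wb]
    by_cases hic : i = c
    · rw [hic, hc, Function.update_of_ne hac.symm, Function.update_self,
        Function.update_of_ne hab, Function.update_of_ne hac, wa]
    rw [hd hia hib hic, Function.update_of_ne hia, Function.update_of_ne hib]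
  rw [k2, k3]
  nth_rewrite 1 [k1]
  linear_combination (Equiv.Perm.sign σ : k) * key

/-- By the cyclic relation, pairSum C a b - pairSum C c b equals pairSum C a c for every b,
including b = a and b = c; summing over the m + 2 positions gives a multiple of the characteristic.
-/
theorem IsPrimitive.firstSum_eq (hC : IsPrimitive C) (hk : ((m + 2 : ℕ) : k) = 0)
    (a c : Fin (m + 2)) : firstSum C a = firstSum C c := by
  by_cases hac : a = c
  · rw [hac]
  have h0 (a : Fin (m + 2)) : pairSum C a a = 0 :=
    Finset.sum_eq_zero fun σ _ => if_neg fun h => by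
      have := σ.injective (h.1.trans h.2.symm)
      simp at this
  have h (b : Fin (m + 2)) : pairSum C a b - pairSum C c b = pairSum C a c := by
    by_cases hab : a = b
    · rw [← hab, h0, pairSum_swap C a c]
      ring
    by_cases hbc : b = c
    · rw [hbc, h0, sub_zero]
    have := hC.pairSum_add_pairSum_add_pairSum hab hbc hac
    rw [pairSum_swap C a c, pairSum_swap C c b] at this
    linear_combination this
  rw [← sub_eq_zero, firstSum_eq_sum_pairSum, firstSum_eq_sum_pairSum, ← Finset.sum_sub_distrib,
    Finset.sum_congr rfl fun b _ => h b, Finset.sum_const, Finset.card_univ, Fintype.card_fin,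
    nsmul_eq_mul, hk, zero_mul]

end Words

end

end OddLie

namespace OddLie

noncomputable section

variable {k : Type*} [Field k] {V : Type*} [AddCommGroup V] [Module k V]

/-! ### Word coefficients, transvections and invariant tensors -/

section Coordinates

variable {m : ℕ} (b : Module.Basis (Fin (m + 1)) k V)

/-- The functional `x_0 ⊗ ⋯ ⊗ x_{n-1} ↦ ∏ i, b_{w i}^*(x_i)` taking the coefficient of the word
`w`. -/
def wordCoord {n : ℕ} (w : Fin n → Fin (m + 1)) : (⨂[k]^n V) →ₗ[k] k :=
  PiTensorProduct.lift
    ((MultilinearMap.mkPiAlgebra k (Fin n) k).compLinearMap fun i => b.coord (w i))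

theorem wordCoord_tprod {n : ℕ} (w : Fin n → Fin (m + 1)) (x : Fin n → V) :
    wordCoord b w (PiTensorProduct.tprod k x) = ∏ i, b.coord (w i) (x i) := by
  simp [wordCoord]

theorem basis_det_eq_sum (y : Fin (m + 1) → V) :
    b.det y = ∑ σ : Equiv.Perm (Fin (m + 1)),
      (Equiv.Perm.sign σ : k) * ∏ i, b.coord i (y (σ i)) := by
  rw [b.det_apply, ← Matrix.det_transpose, Matrix.det_apply']
  rfl

/-- A permutation with σ 0 = a is `swap 0 a` times a permutation of the remaining m + 1 indices;
summing over the latter is the Leibniz formula. -/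
theorem firstSum_wordCoord_tprod (a : Fin (m + 2)) (x : Fin (m + 2) → V) :
    firstSum (fun w => wordCoord b w (PiTensorProduct.tprod k x)) a =
      (if a = 0 then 1 else -1) *
        (b.coord 0 (x a) * b.det fun i : Fin (m + 1) => x (Equiv.swap 0 a i.succ)) := by
  have h (σ : Equiv.Perm (Fin (m + 2))) : wordCoord b (word σ) (PiTensorProduct.tprod k x) =
      b.coord 0 (x (σ 0)) * ∏ i : Fin (m + 1), b.coord i (x (σ i.succ)) := by
    rw [wordCoord_tprod, ← Equiv.prod_comp σ, Fin.prod_univ_succ]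
    simp only [word_apply, Fin.cons_zero, Fin.cons_succ, id]
  simp only [firstSum, h]
  rw [← Equiv.sum_comp Equiv.Perm.decomposeFin.symm, Fintype.sum_prod_type, basis_det_eq_sum,
    Finset.mul_sum, Finset.mul_sum, Finset.sum_eq_single a]
  · refine Finset.sum_congr rfl fun σ _ => ?_
    simp only [Equiv.Perm.decomposeFin_symm_apply_zero, if_true,
      Equiv.Perm.decomposeFin.symm_sign, Equiv.Perm.decomposeFin_symm_apply_succ]
    split_ifs <;> push_cast <;> ring
  · intro c _ hc
    refine Finset.sum_eq_zero fun σ _ => ?_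
    rw [Equiv.Perm.decomposeFin_symm_apply_zero, if_neg hc]
  · simp

/-- Both terms of the image of a pure tensor enter with sign +; the minus sign here is that of the
transposition (0 1). -/
theorem hookCoord_zero_barToHook (t : ⨂[k]^(m + 2) V) :
    hookCoord b 0 (barToHook k V m (toLBar k V (m + 2) (beta k V (m + 2) t))) =
      firstSum (fun w => wordCoord b w t) 0 - firstSum (fun w => wordCoord b w t) 1 := by
  induction t using PiTensorProduct.induction_on with
  | smul_tprod c x =>
    have h0 : (fun i : Fin (m + 1) => x (Equiv.swap 0 0 i.succ)) =
        Fin.cons (x 1) fun i : Fin m => x i.succ.succ := by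
      funext i
      rw [Equiv.swap_self, Equiv.refl_apply]
      refine Fin.cases ?_ (fun i => ?_) i <;> simp
    have h1 : (fun i : Fin (m + 1) => x (Equiv.swap 0 1 i.succ)) =
        Fin.cons (x 0) fun i : Fin m => x i.succ.succ := by
      funext i
      refine Fin.cases ?_ (fun i => ?_) i
      · rw [Fin.succ_zero_eq_one, Equiv.swap_apply_right, Fin.cons_zero]
      · rw [Equiv.swap_apply_of_ne_of_ne (Fin.succ_ne_zero _) (Fin.succ_succ_ne_one i),
          Fin.cons_succ]
    have hs (a : Fin (m + 2)) :
        firstSum (fun w => wordCoord b w (c • PiTensorProduct.tprod k x)) a =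
          c * firstSum (fun w => wordCoord b w (PiTensorProduct.tprod k x)) a := by
      simp only [firstSum, map_smul, smul_eq_mul, Finset.mul_sum, mul_ite, mul_zero]
      exact Finset.sum_congr rfl fun σ _ => by split_ifs <;> ring
    rw [hs, hs, firstSum_wordCoord_tprod, firstSum_wordCoord_tprod, h0, h1]
    simp only [map_smul, barToHook_toLBar_beta_tprod, map_add, hookCoord_tmul_ιMulti, smul_eq_mul]
    rw [if_pos trivial, if_neg (by simp)]
    ring
  | add s t hs ht =>
    have h (a : Fin (m + 2)) : firstSum (fun w => wordCoord b w (s + t)) a =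
        firstSum (fun w => wordCoord b w s) a + firstSum (fun w => wordCoord b w t) a := by
      simp only [firstSum, map_add, ← Finset.sum_add_distrib]
      exact Finset.sum_congr rfl fun σ _ => by split_ifs <;> ring
    rw [h, h]
    simp only [map_add, hs, ht]
    ring

/-- The transvection `b_j ↦ b_j + s b_0` as an element of `GL(V)`. -/
def elementary {j : Fin (m + 1)} (hj : j ≠ 0) (s : k) : LinearMap.GeneralLinearGroup k V :=
  LinearMap.GeneralLinearGroup.ofLinearEquiv
    (LinearEquiv.transvection (f := b.coord j) (v := s • b 0) (by simp [hj.symm]))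

variable {b}

theorem stdRep_elementary {j : Fin (m + 1)} (hj : j ≠ 0) (s : k) (v : V) :
    stdRep k V (elementary b hj s) v = v + (s * b.coord j v) • b 0 := by
  change v + b.coord j v • s • b 0 = _
  rw [smul_smul, mul_comm]

theorem coord_stdRep_elementary {j : Fin (m + 1)} (hj : j ≠ 0) (s : k) (i : Fin (m + 1)) (v : V) :
    b.coord i (stdRep k V (elementary b hj s) v) =
      b.coord i v + if i = 0 then s * b.coord j v else 0 := by
  rw [stdRep_elementary, map_add, map_smul]
  by_cases hi : i = 0 <;> simp [hi]

theorem det_stdRep_elementary {j : Fin (m + 1)} (hj : j ≠ 0) (s : k) (y : Fin (m + 1) → V) :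
    (b.det fun i => stdRep k V (elementary b hj s) (y i)) = b.det y := by
  have h0 : b.coord j (s • b 0) = 0 := by simp [hj.symm]
  have h1 := LinearEquiv.transvection.det_eq_one h0
  rw [← Units.val_inj, LinearEquiv.coe_det] at h1
  have h2 := b.det_comp (LinearEquiv.transvection h0 : V →ₗ[k] V) y
  rw [h1, Units.val_one, one_mul] at h2
  exact h2

variable (b) in
/-- The vector `b_0 ⊗ (b_0 ∧ ⋯ ∧ b_m)`. -/
def hookHighest : V ⊗[k] (⋀[k]^(m + 1) V) := b 0 ⊗ₜ exteriorPower.ιMulti k (m + 1) b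

theorem tprod_elementary_tmul_ιMulti {j : Fin (m + 1)} (hj : j ≠ 0) (s : k) (v : V)
    (y : Fin (m + 1) → V) :
    (stdRep k V).tprod (exteriorPowerRep k V (m + 1)) (elementary b hj s)
      (v ⊗ₜ exteriorPower.ιMulti k (m + 1) y) =
      stdRep k V (elementary b hj s) v ⊗ₜ
        exteriorPower.ιMulti k (m + 1) fun i => stdRep k V (elementary b hj s) (y i) := by
  rw [Representation.tprod_apply, TensorProduct.map_tmul]
  congr 1
  exact exteriorPower.map_apply_ιMulti _ _

theorem tprod_elementary_hookHighest {j : Fin (m + 1)} (hj : j ≠ 0) (s : k) :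
    (stdRep k V).tprod (exteriorPowerRep k V (m + 1)) (elementary b hj s) (hookHighest b) =
      hookHighest b := by
  rw [hookHighest, tprod_elementary_tmul_ιMulti, ιMulti_eq_det_smul b, det_stdRep_elementary,
    b.det_self, one_smul, stdRep_elementary]
  simp [hj.symm]

/-- Consequently a vector fixed by this transvection has zero j-th coordinate. -/
theorem hookCoord_zero_tprod_elementary {j : Fin (m + 1)} (hj : j ≠ 0)
    (z : V ⊗[k] (⋀[k]^(m + 1) V)) :
    hookCoord b 0 ((stdRep k V).tprod (exteriorPowerRep k V (m + 1)) (elementary b hj 1) z) =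
      hookCoord b 0 z + hookCoord b j z := by
  have : hookCoord b 0 ∘ₗ (stdRep k V).tprod (exteriorPowerRep k V (m + 1)) (elementary b hj 1) =
      hookCoord b 0 + hookCoord b j := by
    refine TensorProduct.ext (LinearMap.ext fun v => exteriorPower.linearMap_ext
      (AlternatingMap.ext fun y => ?_))
    change hookCoord b 0 ((stdRep k V).tprod (exteriorPowerRep k V (m + 1)) (elementary b hj 1)
      (v ⊗ₜ exteriorPower.ιMulti k (m + 1) y)) =
      hookCoord b 0 (v ⊗ₜ exteriorPower.ιMulti k (m + 1) y) +
        hookCoord b j (v ⊗ₜ exteriorPower.ιMulti k (m + 1) y)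
    rw [tprod_elementary_tmul_ιMulti, hookCoord_tmul_ιMulti, hookCoord_tmul_ιMulti,
      hookCoord_tmul_ιMulti, coord_stdRep_elementary, det_stdRep_elementary, if_pos rfl]
    ring
  exact DFunLike.congr_fun this z

theorem prod_eq_mul_mul_mul_prod_erase {ι M : Type*} [CommMonoid M] [Fintype ι] [DecidableEq ι]
    (f : ι → M) {a b c : ι} (hab : a ≠ b) (hbc : b ≠ c) (hac : a ≠ c) :
    ∏ i, f i = f a * f b * f c * ∏ i ∈ ((Finset.univ.erase a).erase b).erase c, f i := by
  rw [← Finset.mul_prod_erase Finset.univ f (Finset.mem_univ a),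
    ← Finset.mul_prod_erase (Finset.univ.erase a) f (by simp [hab.symm] : b ∈ _),
    ← Finset.mul_prod_erase ((Finset.univ.erase a).erase b) f
      (by simp [hbc.symm, hac.symm] : c ∈ _)]
  simp only [mul_assoc]

/-- Expansion in powers of `s` of the coefficient of a word with three letters `0` under the
transvection `b_j ↦ b_j + s b_0`. -/
theorem wordCoord_tensorPowerRep_elementary {n : ℕ} {u : Fin n → Fin (m + 1)} {p q r : Fin n}
    {j : Fin (m + 1)} (hpq : p ≠ q) (hqr : q ≠ r) (hpr : p ≠ r) (hj : j ≠ 0)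
    (hu : ∀ i, u i = 0 ↔ i = p ∨ i = q ∨ i = r) (s : k) (t : ⨂[k]^n V) :
    wordCoord b u (tensorPowerRep k V n (elementary b hj s) t) =
      wordCoord b u t +
      s * (wordCoord b (Function.update u p j) t + wordCoord b (Function.update u q j) t +
        wordCoord b (Function.update u r j) t) +
      s ^ 2 * (wordCoord b (Function.update (Function.update u p j) q j) t +
        wordCoord b (Function.update (Function.update u p j) r j) t +
        wordCoord b (Function.update (Function.update u q j) r j) t) +
      s ^ 3 * wordCoord b
        (Function.update (Function.update (Function.update u p j) q j) r j) t := by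
  induction t using PiTensorProduct.induction_on with
  | smul_tprod c x =>
    have h : tensorPowerRep k V n (elementary b hj s) (PiTensorProduct.tprod k x) =
        PiTensorProduct.tprod k fun i => stdRep k V (elementary b hj s) (x i) :=
      PiTensorProduct.map_tprod _ _
    have hw (w : Fin n → Fin (m + 1)) (hw : ∀ i, i ≠ p → i ≠ q → i ≠ r → w i = u i) :
        ∏ i, b.coord (w i) (x i) =
          b.coord (w p) (x p) * b.coord (w q) (x q) * b.coord (w r) (x r) *
            ∏ i ∈ ((Finset.univ.erase p).erase q).erase r, b.coord (u i) (x i) := by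
      rw [prod_eq_mul_mul_mul_prod_erase _ hpq hqr hpr]
      congr 1
      refine Finset.prod_congr rfl fun i hi => ?_
      simp only [Finset.mem_erase] at hi
      rw [hw i hi.2.2.1 hi.2.1 hi.1]
    have hg : ∏ i, b.coord (u i) (stdRep k V (elementary b hj s) (x i)) =
        (b.coord 0 (x p) + s * b.coord j (x p)) * (b.coord 0 (x q) + s * b.coord j (x q)) *
          (b.coord 0 (x r) + s * b.coord j (x r)) *
            ∏ i ∈ ((Finset.univ.erase p).erase q).erase r, b.coord (u i) (x i) := by
      rw [prod_eq_mul_mul_mul_prod_erase _ hpq hqr hpr]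
      simp only [coord_stdRep_elementary, (hu p).2 (.inl rfl), (hu q).2 (.inr (.inl rfl)),
        (hu r).2 (.inr (.inr rfl)), if_true]
      congr 1
      refine Finset.prod_congr rfl fun i hi => ?_
      simp only [Finset.mem_erase] at hi
      rw [if_neg (by simp [hu, hi]), add_zero]
    simp only [map_smul, h, wordCoord_tprod, smul_eq_mul, hg]
    rw [hw u (by simp), hw (Function.update u p j) (by simp +contextual),
      hw (Function.update u q j) (by simp +contextual),
      hw (Function.update u r j) (by simp +contextual),
      hw (Function.update (Function.update u p j) q j) (by simp +contextual),
      hw (Function.update (Function.update u p j) r j) (by simp +contextual),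
      hw (Function.update (Function.update u q j) r j) (by simp +contextual),
      hw (Function.update (Function.update (Function.update u p j) q j) r j)
        (by simp +contextual)]
    simp only [Function.update_self, Function.update_of_ne hpq, Function.update_of_ne hpq.symm,
      Function.update_of_ne hqr, Function.update_of_ne hqr.symm, Function.update_of_ne hpr,
      Function.update_of_ne hpr.symm, (hu p).2 (.inl rfl), (hu q).2 (.inr (.inl rfl)),
      (hu r).2 (.inr (.inr rfl))]
    ring
  | add t t' ht ht' =>
    simp only [map_add, ht, ht']
    ring

/-- Invariance makes a cubic polynomial in s without constant term vanish for all s; primitivity is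
the vanishing of its linear coefficient. -/
theorem isPrimitive_wordCoord [Infinite k] (h2 : (2 : k) ≠ 0) {t : ⨂[k]^(m + 2) V}
    (ht : ∀ (j : Fin (m + 1)) (hj : j ≠ 0) (s : k),
      tensorPowerRep k V (m + 2) (elementary b hj s) t = t) :
    IsPrimitive fun w => wordCoord b w t := by
  intro u p q r j hpq hqr hpr hj hu
  have h (s : k) := wordCoord_tensorPowerRep_elementary (b := b) hpq hqr hpr hj hu s t
  simp only [ht] at h
  classical
  -- The values 1, -1 and s must be distinct and nonzero to isolate the linear coefficient; over the
  -- field with three elements s ^ 3 - s vanishes identically.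
  obtain ⟨s, hs⟩ := Infinite.exists_notMem_finset ({0, 1, -1} : Finset k)
  simp only [Finset.mem_insert, Finset.mem_singleton, not_or] at hs
  obtain ⟨hs0, hs1, hs2⟩ := hs
  have e1 := h 1
  have e2 := h (-1)
  have e3 := h s
  set c₁ := wordCoord b (Function.update u p j) t + wordCoord b (Function.update u q j) t +
    wordCoord b (Function.update u r j) t
  set c₂ := wordCoord b (Function.update (Function.update u p j) q j) t +
    wordCoord b (Function.update (Function.update u p j) r j) t +
    wordCoord b (Function.update (Function.update u q j) r j) t
  set c₃ := wordCoord b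
    (Function.update (Function.update (Function.update u p j) q j) r j) t
  have hc₂ : c₂ = 0 := by
    have : 2 * c₂ = 0 := by linear_combination - e1 - e2
    exact (mul_eq_zero.1 this).resolve_left h2
  have hc₁ : (s * (1 - s) * (1 + s)) * c₁ = 0 := by
    linear_combination s ^ 3 * e1 - e3 + (s ^ 3 - s ^ 2) * hc₂
  refine (mul_eq_zero.1 hc₁).resolve_left (mul_ne_zero (mul_ne_zero hs0 ?_) ?_)
  · exact sub_ne_zero.2 (Ne.symm hs1)
  · exact fun h => hs2 (by linear_combination h)

/-- The 0-th coordinate vanishes by the characteristic. The image is again fixed by the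
transvections, which forces the other coordinates to vanish. -/
theorem toLBar_beta_eq_zero [Infinite k] (b : Module.Basis (Fin (m + 1)) k V) (h2 : (2 : k) ≠ 0)
    (hk : ((m + 2 : ℕ) : k) = 0) {t : ⨂[k]^(m + 2) V}
    (ht : ∀ (j : Fin (m + 1)) (hj : j ≠ 0) (s : k),
      tensorPowerRep k V (m + 2) (elementary b hj s) t = t) :
    toLBar k V (m + 2) (beta k V (m + 2) t) = 0 := by
  refine (barToHook_bijective b h2).1 ?_
  rw [map_zero]
  have h0 : hookCoord b 0
      (barToHook k V m (toLBar k V (m + 2) (beta k V (m + 2) t))) = 0 := by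
    rw [hookCoord_zero_barToHook, (isPrimitive_wordCoord h2 ht).firstSum_eq hk 0 1, sub_self]
  refine eq_zero_of_hookCoord_eq_zero b fun j => ?_
  by_cases hj : j = 0
  · rw [hj, h0]
  have h := hookCoord_zero_tprod_elementary (b := b) hj
    (barToHook k V m (toLBar k V (m + 2) (beta k V (m + 2) t)))
  rwa [← barToHook_equivariant, ← Representation.IntertwiningMap.isIntertwining,
    ← Representation.IntertwiningMap.isIntertwining, ht, left_eq_add] at h

theorem no_equivariant_section [Infinite k] (b : Module.Basis (Fin (m + 1)) k V)
    (h2 : (2 : k) ≠ 0) (hk : ((m + 2 : ℕ) : k) = 0)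
    (e : (LBarRep k V (m + 2)).Equiv ((stdRep k V).tprod (exteriorPowerRep k V (m + 1)))) :
    ¬ ∃ φ : ((stdRep k V).tprod (exteriorPowerRep k V (m + 1))).IntertwiningMap
        (tensorPowerRep k V (m + 2)),
      (e.toIntertwiningMap.comp ((toLBar k V (m + 2)).comp (beta k V (m + 2)))).comp φ =
        Representation.IntertwiningMap.id _ := by
  rintro ⟨φ, hφ⟩
  have h1 : e.toIntertwiningMap
      (toLBar k V (m + 2) (beta k V (m + 2) (φ (hookHighest b)))) = hookHighest b :=
    DFunLike.congr_fun hφ (hookHighest b)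
  rw [toLBar_beta_eq_zero b h2 hk fun j hj s => by
    rw [← Representation.IntertwiningMap.isIntertwining, tprod_elementary_hookHighest],
    map_zero] at h1
  have h3 := congrArg (hookCoord b 0) h1
  rw [hookHighest, hookCoord_tmul_ιMulti, b.det_self] at h3
  simp at h3

end Coordinates

end

end OddLie

theorem lemma3p6 {k : Type*} [Field k] [IsAlgClosed k] (p : ℕ) (hp : p.Prime) (hp2 : 2 < p)
    [CharP k p] {V : Type*} [AddCommGroup V] [Module k V] (hV : Module.finrank k V = p - 1) :
    Function.Surjective (OddLie.beta k V p) ∧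
    Function.Surjective (OddLie.toLBar k V p) ∧
    Nonempty ((OddLie.LBarRep k V p).Equiv
      ((OddLie.stdRep k V).tprod (OddLie.exteriorPowerRep k V (p - 1)))) ∧
    ∀ e : (OddLie.LBarRep k V p).Equiv
        ((OddLie.stdRep k V).tprod (OddLie.exteriorPowerRep k V (p - 1))),
      ¬ ∃ φ : ((OddLie.stdRep k V).tprod
            (OddLie.exteriorPowerRep k V (p - 1))).IntertwiningMap (OddLie.tensorPowerRep k V p),
          (e.toIntertwiningMap.comp ((OddLie.toLBar k V p).comp (OddLie.beta k V p))).comp φ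
            = Representation.IntertwiningMap.id _ := by
  obtain ⟨m, rfl⟩ : ∃ m, p = m + 2 := ⟨p - 2, by omega⟩
  -- The truncated difference m + 2 - 1 reduces to m + 1 by definition, so the exterior powers in
  -- the goal match those of the lemmas.
  change Module.finrank k V = m + 1 at hV
  have hk : ((m + 2 : ℕ) : k) = 0 := CharP.cast_eq_zero k (m + 2)
  have h2 : (2 : k) ≠ 0 := Ring.two_ne_zero (by rw [ringChar.eq k (m + 2)]; omega)
  have : Infinite k := IsAlgClosed.instInfinite
  have : Module.Finite k V := Module.finite_of_finrank_pos (by omega)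
  let b : Module.Basis (Fin (m + 1)) k V := Module.finBasisOfFinrankEq k V hV
  exact ⟨OddLie.beta_surjective _, OddLie.toLBar_surjective _, ⟨OddLie.barEquivHook b h2⟩,
    OddLie.no_equivariant_section b h2 hk⟩
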